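/- **Local linear convergence of the SCF iteration.** Let $L\in\mathbb{R}^{n\times n}$ be symmetric with Moore–Penrose pseudo-inverse $L^\dagger$, let $V_{ion}\in\mathbb{R}^{n\times n}$ be diagonal, let $w_1,\dots,w_m\in\mathbb{R}^n$, and let $\epsilon_{xc}:\mathbb{R}^n\to\mathbb{R}^n$ have Jacobian $\mu_{xc}(\rho)=\partial\epsilon_{xc}/\partial\rho$; let $e$ be the all-ones vector. For $X\in\mathbb{R}^{n\times k}$ put $\rho(X)=\mathrm{diag}(XX^{\mathrm T})\in\mathbb{R}^n$ and $$H(X)=\tfrac12 L+V_{ion}+\sum_l w_lw_l^{\mathrm T}+\mathrm{Diag}\big(L^\dagger\rho(X)\big)+\mathrm{Diag}\big(\mu_{xc}(\rho(X))^{\mathrm T}e\big).$$ Assume that $\epsilon_{xc}$ is twice differentiable and that $\sigma$ is a constant with $$\|\mathrm{Diag}(\mu_{xc}(\rho)^{\mathrm T}e)-\mathrm{Diag}(\mu_{xc}(\tilde\rho)^{\mathrm T}e)\|_F\le\sigma\|\rho-\tilde\rho\|_2,\qquad \Big\|\frac{\partial^2\epsilon_{xc}}{\partial\rho^2}e\Big\|_2\le\sigma\qquad\text{for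 all }\rho,\tilde\rho\in\mathbb{R}^n .$$ For $X,Y\in\mathbb{R}^{n\times k}$, call $Y$ an *SCF iterate* obtained from $X$ if $Y^{\mathrm T}Y=I$ and $H(X)Y=Y\,Q\Lambda Q^{\mathrm T}$, where $\Lambda$ is the diagonal matrix of the $k$ smallest eigenvalues of $H(X)$ (with multiplicity) and $Q\in\mathbb{R}^{k\times k}$ is some orthogonal matrix; that is, up to an orthogonal change of basis, the columns of $Y$ are orthonormal eigenvectors of $H(X)$ for its $k$ smallest eigenvalues. Call $X^*$ a *solution of the Kohn–Sham equation* if $X^*$ is an SCF iterate obtained from $X^*$ itself. Let $\mathbf{d_{p2}}(X_1,X_2)=\|X_1X_1^{\mathrm T}-X_2X_2^{\mathrm T}\|_2$. Let $X^*$ be a solution of the Kohn–Sham equation, let $1\le k<n$, let $\lambda_1\le\dots\le\lambda_n$ be the eigenvalues of $H(X^*)$, and let $\delta>0$ satisfy $\lambda_{k+1}-\lambda_k\ge\delta$. Then: 1. There are constants $C$ and $\varepsilon>0$ such that, for every $X\in\mathbb{R}^{n\times k}$ with $X^{\mathrm T}X=I$ and $\mathbf{d_{p2}}(X^*,X)<\varepsilon$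 and every SCF iterate $Y$ obtained from $X$, $$\mathbf{d_{p2}}(X^*,Y)\le\frac{2\sqrt n\,(\|L^\dagger\|_2+\sigma)}{\delta}\,\mathbf{d_{p2}}(X^*,X)+C\,\mathbf{d_{p2}}(X^*,X)^2 .$$ 2. Consequently, if $2\sqrt n\,(\|L^\dagger\|_2+\sigma)<\delta$, then SCF converges linearly near $X^*$: for every $q$ with $\frac{2\sqrt n(\|L^\dagger\|_2+\sigma)}{\delta}<q<1$ there is $\varepsilon>0$ such that every sequence $X^0,X^1,\dots$ in which $(X^0)^{\mathrm T}X^0=I$, $\mathbf{d_{p2}}(X^*,X^0)<\varepsilon$ and each $X^{i+1}$ is an SCF iterate obtained from $X^i$ satisfies $\mathbf{d_{p2}}(X^*,X^{i+1})\le q\,\mathbf{d_{p2}}(X^*,X^i)$ for all $i\ge0$ and $\mathbf{d_{p2}}(X^*,X^i)\to0$. -/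

import Mathlib

open Matrix Filter Topology

noncomputable section

namespace KohnSham

/-- The spectral norm `‖A‖₂` of a real matrix (operator norm for the Euclidean norms). -/
def norm2 {m n : ℕ} (A : Matrix (Fin m) (Fin n) ℝ) : ℝ :=
  ‖LinearMap.toContinuousLinearMap (Matrix.toEuclideanLin A)‖

/-- The Frobenius norm `‖A‖_F` of a real matrix. -/
def normF {m n : ℕ} (A : Matrix (Fin m) (Fin n) ℝ) : ℝ :=
  Real.sqrt (∑ i, ∑ j, A i j ^ 2)

/-- The Euclidean norm `‖v‖₂` of a vector in `ℝⁿ`. -/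
def vecNorm2 {n : ℕ} (v : Fin n → ℝ) : ℝ := ‖WithLp.toLp 2 v‖

/-- The eigenvalues `λ₁ ≤ … ≤ λₙ` of a real symmetric matrix, in increasing order and with
multiplicity; the index is zero-based, so that the value at `j` is `λ_{j+1}`. -/
def ascEigenvalue {n : ℕ} {A : Matrix (Fin n) (Fin n) ℝ} (hA : A.IsHermitian) (j : Fin n) : ℝ :=
  hA.eigenvalues₀ (Fin.cast (Fintype.card_fin n).symm j.rev)

theorem ascEigenvalue_monotone {n : ℕ} {A : Matrix (Fin n) (Fin n) ℝ} (hA : A.IsHermitian) :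
    Monotone (ascEigenvalue hA) := by
  intro i j hij
  apply hA.eigenvalues₀_antitone
  simpa using hij

/-- There is a gap of at least `δ > 0` between the `k`-th and the `(k+1)`-st smallest eigenvalue
(in particular `1 ≤ k < n`). -/
def HasGap {n : ℕ} {A : Matrix (Fin n) (Fin n) ℝ} (hA : A.IsHermitian) (k : ℕ) (δ : ℝ) : Prop :=
  0 < δ ∧ ∃ i j : Fin n, (i : ℕ) + 1 = k ∧ (j : ℕ) = k ∧
    δ ≤ ascEigenvalue hA j - ascEigenvalue hA i

/-- The Moore-Penrose pseudo-inverse of a real symmetric matrix, `U Diag(λᵢ⁺) Uᵀ` for a spectral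
decomposition `U Diag(λᵢ) Uᵀ`, where `λ⁺ = 1 / λ` for `λ ≠ 0` and `0⁺ = 0` (which is Lean's
convention for the inverse of `0`). -/
def pinv {n : ℕ} {A : Matrix (Fin n) (Fin n) ℝ} (hA : A.IsHermitian) : Matrix (Fin n) (Fin n) ℝ :=
  (hA.eigenvectorUnitary : Matrix (Fin n) (Fin n) ℝ) *
    diagonal (fun i => (hA.eigenvalues i)⁻¹) *
    (hA.eigenvectorUnitary : Matrix (Fin n) (Fin n) ℝ)ᵀ

/-- The four Penrose equations, which characterise the pseudo-inverse. -/
theorem pinv_penrose {n : ℕ} {A : Matrix (Fin n) (Fin n) ℝ} (hA : A.IsHermitian) :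
    A * pinv hA * A = A ∧ pinv hA * A * pinv hA = pinv hA ∧
      (A * pinv hA)ᵀ = A * pinv hA ∧ (pinv hA * A)ᵀ = pinv hA * A := by
  obtain ⟨U, hU⟩ : ∃ U : Matrix (Fin n) (Fin n) ℝ,
      U = (hA.eigenvectorUnitary : Matrix (Fin n) (Fin n) ℝ) := ⟨_, rfl⟩
  have hUU : Uᵀ * U = 1 := by
    have := (Matrix.mem_unitaryGroup_iff').1 hA.eigenvectorUnitary.2
    rw [hU]; simpa [star_eq_conjTranspose] using this
  have hspec : A = U * diagonal hA.eigenvalues * Uᵀ := by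
    have := hA.spectral_theorem
    rw [Unitary.conjStarAlgAut_apply] at this
    rw [hU]
    simpa [star_eq_conjTranspose, Function.comp_def] using this
  have hp : pinv hA = U * diagonal (fun i => (hA.eigenvalues i)⁻¹) * Uᵀ := by rw [hU]; rfl
  generalize hA.eigenvalues = d at hspec hp
  have key : ∀ a b : Fin n → ℝ, (U * diagonal a * Uᵀ) * (U * diagonal b * Uᵀ) =
      U * diagonal (fun i => a i * b i) * Uᵀ := by
    intro a b
    calc _ = U * diagonal a * (Uᵀ * U) * diagonal b * Uᵀ := by simp only [Matrix.mul_assoc]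
      _ = _ := by rw [hUU, Matrix.mul_one, Matrix.mul_assoc U, diagonal_mul_diagonal]
  have htr : ∀ a : Fin n → ℝ, (U * diagonal a * Uᵀ)ᵀ = U * diagonal a * Uᵀ := by
    intro a
    simp only [transpose_mul, transpose_transpose, diagonal_transpose, Matrix.mul_assoc]
  have h1 : (fun i => d i * (d i)⁻¹ * d i) = d := by
    funext i; by_cases h : d i = 0 <;> simp [h]
  have h2 : (fun i => (d i)⁻¹ * d i * (d i)⁻¹) = fun i => (d i)⁻¹ := by
    funext i; by_cases h : d i = 0 <;> simp [h]
  rw [hp, hspec, key, key, key, key, h1, h2]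
  exact ⟨rfl, rfl, htr _, htr _⟩

/-- The data of a discretised Kohn-Sham model on `n` grid points: the discretised Laplacian `L`
(a symmetric matrix), the diagonal of the local ionic pseudopotential, the nonlocal projection
vectors `w₁, …, w_m`, and the exchange correlation functional `ε_xc : ℝⁿ → ℝⁿ`. -/
structure Model (n m : ℕ) where
  L : Matrix (Fin n) (Fin n) ℝ
  isHermitian_L : L.IsHermitian
  Vion : Fin n → ℝ
  w : Fin m → Fin n → ℝ
  εxc : (Fin n → ℝ) → (Fin n → ℝ)

/-- The charge density `ρ(X) = diag(X Xᵀ)`. -/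
def density {n k : ℕ} (X : Matrix (Fin n) (Fin k) ℝ) : Fin n → ℝ := (X * Xᵀ).diag

/-- The projection 2-norm distance `‖X₁ X₁ᵀ - X₂ X₂ᵀ‖₂`. -/
def dp2 {n k : ℕ} (X₁ X₂ : Matrix (Fin n) (Fin k) ℝ) : ℝ := norm2 (X₁ * X₁ᵀ - X₂ * X₂ᵀ)

/-- `Y` has orthonormal columns spanning an invariant subspace of the symmetric matrix `A` that
belongs to its `k` smallest eigenvalues: `A Y = Y (Q Λ Qᵀ)`, where `Λ` is the diagonal matrix of
these eigenvalues and `Q` is an orthogonal matrix. For `Q = 1` the columns of `Y` are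
eigenvectors; `Q` expresses that `Y` may be replaced by `Y U` for any orthogonal `U`. -/
def IsLowestEigenbasis {n k : ℕ} {A : Matrix (Fin n) (Fin n) ℝ} (hA : A.IsHermitian)
    (Y : Matrix (Fin n) (Fin k) ℝ) : Prop :=
  Yᵀ * Y = 1 ∧ ∃ (h : k ≤ n) (Q : Matrix (Fin k) (Fin k) ℝ), Qᵀ * Q = 1 ∧
    A * Y = Y * (Q * diagonal (fun j => ascEigenvalue hA (Fin.castLE h j)) * Qᵀ)

namespace Model

variable {n m k : ℕ} (M : Model n m)

/-- The pseudo-inverse `L†`. -/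
def Ldag : Matrix (Fin n) (Fin n) ℝ := pinv M.isHermitian_L

/-- The Jacobian `μ_xc(ρ) = ∂ε_xc/∂ρ`, with entries `∂(ε_xc)ᵢ/∂ρⱼ`. -/
def μxc (ρ : Fin n → ℝ) : Matrix (Fin n) (Fin n) ℝ :=
  Matrix.of fun i j => fderiv ℝ M.εxc ρ (Pi.single j 1) i

/-- The vector `μ_xc(ρ)ᵀ e`, where `e` is the all-ones vector. -/
def vxc (ρ : Fin n → ℝ) : Fin n → ℝ := (M.μxc ρ)ᵀ *ᵥ (fun _ => 1)

/-- The matrix `(∂²ε_xc/∂ρ²) e`, with entries `∑ᵢ ∂²(ε_xc)ᵢ/∂ρⱼ∂ρₗ`. -/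
def hessxc (ρ : Fin n → ℝ) : Matrix (Fin n) (Fin n) ℝ :=
  Matrix.of fun j l => ∑ i, fderiv ℝ (fderiv ℝ M.εxc) ρ (Pi.single l 1) (Pi.single j 1) i

/-- The Hamiltonian
`H(X) = L/2 + V_ion + ∑ₗ wₗ wₗᵀ + Diag(L† ρ(X)) + Diag(μ_xc(ρ(X))ᵀ e)`. -/
def hamiltonian (X : Matrix (Fin n) (Fin k) ℝ) : Matrix (Fin n) (Fin n) ℝ :=
  (1 / 2 : ℝ) • M.L + diagonal M.Vion + ∑ l, vecMulVec (M.w l) (M.w l) +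
    diagonal (M.Ldag *ᵥ density X) + diagonal (M.vxc (density X))

theorem isHermitian_hamiltonian (X : Matrix (Fin n) (Fin k) ℝ) :
    (M.hamiltonian X).IsHermitian := by
  have hL : M.Lᵀ = M.L := by simpa [IsHermitian] using M.isHermitian_L
  unfold hamiltonian
  rw [IsHermitian, conjTranspose_eq_transpose_of_trivial]
  simp only [transpose_add, transpose_smul, diagonal_transpose, transpose_sum,
    transpose_vecMulVec, hL]

/-- The assumption on the exchange correlation functional: it is twice differentiable, its
potential `μ_xc(ρ)ᵀ e` is Lipschitz with constant `σ`, and its second derivative contracted with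
`e` has spectral norm at most `σ`, on all of `ℝⁿ`. -/
def XCCondition (σ : ℝ) : Prop :=
  Differentiable ℝ M.εxc ∧ Differentiable ℝ (fderiv ℝ M.εxc) ∧
  (∀ ρ ρ' : Fin n → ℝ,
    normF (diagonal (M.vxc ρ) - diagonal (M.vxc ρ')) ≤ σ * vecNorm2 (ρ - ρ')) ∧
  ∀ ρ : Fin n → ℝ, norm2 (M.hessxc ρ) ≤ σ

/-- `X` solves the Kohn-Sham equation `H(X) X = X Λ`, `Xᵀ X = I`, with `Λ` consisting of the `k`
smallest eigenvalues of `H(X)`. -/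
def IsKSSolution (X : Matrix (Fin n) (Fin k) ℝ) : Prop :=
  IsLowestEigenbasis (M.isHermitian_hamiltonian X) X

/-- `Y` is an SCF iterate obtained from `X`: `H(X) Y = Y Λ`, `Yᵀ Y = I`, with `Λ` consisting of
the `k` smallest eigenvalues of `H(X)`. -/
def IsSCFIterate (X Y : Matrix (Fin n) (Fin k) ℝ) : Prop :=
  IsLowestEigenbasis (M.isHermitian_hamiltonian X) Y

end Model

end KohnSham

end

/-! Passing from `X` to an SCF iterate is a map through `H(X)`, and each half of it is Lipschitz.
First, `X` enters `H(X)` only through the density, so `norm2_hamiltonian_sub_le` gives `‖H(X*) -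
H(X)‖₂ ≤ K d` with `K = √n (‖L†‖₂ + σ)` and `d = dp2 X* X`. Second, Weyl's inequality keeps the
spectral gap open when `K d` is small, and `davis_kahan` then bounds the sine of the largest angle
between the lowest eigenspaces of `H(X*)` and `H(X)` by `K d` over a separation of at least `δ / 2`.
Using it in both directions, `dp2_le` turns the sines into the projector distance. The factor `2` in
the rate pays for the shrinking of the gap, so no quadratic term is needed. Linear convergence
follows by iterating the contraction. -/

namespace KohnSham

/-! ### Elementary inequalities for the Euclidean, spectral and Frobenius norms. -/

section Norms

variable {m n k : ℕ}

theorem vecNorm2_nonneg (v : Fin n → ℝ) : 0 ≤ vecNorm2 v := norm_nonneg _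

theorem vecNorm2_sq (v : Fin n → ℝ) : vecNorm2 v ^ 2 = v ⬝ᵥ v := by
  rw [vecNorm2, EuclideanSpace.norm_sq_eq]
  simp [dotProduct, sq]

theorem vecNorm2_add_le (v w : Fin n → ℝ) : vecNorm2 (v + w) ≤ vecNorm2 v + vecNorm2 w := by
  simpa [vecNorm2] using norm_add_le (WithLp.toLp 2 v) (WithLp.toLp 2 w)

theorem dotProduct_le_vecNorm2 (v w : Fin n → ℝ) : v ⬝ᵥ w ≤ vecNorm2 v * vecNorm2 w := by
  have h := real_inner_le_norm (WithLp.toLp 2 w) (WithLp.toLp 2 v)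
  rw [EuclideanSpace.inner_toLp_toLp] at h
  simpa [vecNorm2, mul_comm] using h

theorem abs_apply_le_vecNorm2 (v : Fin n → ℝ) (i : Fin n) : |v i| ≤ vecNorm2 v := by
  simpa [vecNorm2] using PiLp.norm_apply_le (WithLp.toLp 2 v) i

theorem vecNorm2_le_of_dotProduct_le {v : Fin m → ℝ} {w : Fin n → ℝ} {c : ℝ} (hc : 0 ≤ c)
    (h : v ⬝ᵥ v ≤ c ^ 2 * (w ⬝ᵥ w)) : vecNorm2 v ≤ c * vecNorm2 w := by
  refine (pow_le_pow_iff_left₀ (vecNorm2_nonneg v) (mul_nonneg hc (vecNorm2_nonneg w))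
    two_ne_zero).1 ?_
  rwa [mul_pow, vecNorm2_sq, vecNorm2_sq]

theorem norm2_nonneg (A : Matrix (Fin m) (Fin n) ℝ) : 0 ≤ norm2 A := norm_nonneg _

theorem vecNorm2_mulVec_le (A : Matrix (Fin m) (Fin n) ℝ) (v : Fin n → ℝ) :
    vecNorm2 (A *ᵥ v) ≤ norm2 A * vecNorm2 v := by
  simpa [vecNorm2, norm2] using
    (LinearMap.toContinuousLinearMap (Matrix.toEuclideanLin A)).le_opNorm (WithLp.toLp 2 v)

theorem norm2_le {A : Matrix (Fin m) (Fin n) ℝ} {c : ℝ} (hc : 0 ≤ c)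
    (h : ∀ v, vecNorm2 (A *ᵥ v) ≤ c * vecNorm2 v) : norm2 A ≤ c := by
  refine ContinuousLinearMap.opNorm_le_bound _ hc fun v => ?_
  exact h (WithLp.ofLp v)

theorem norm2_neg (A : Matrix (Fin m) (Fin n) ℝ) : norm2 (-A) = norm2 A := by
  simp [norm2]

theorem norm2_add_le (A B : Matrix (Fin m) (Fin n) ℝ) : norm2 (A + B) ≤ norm2 A + norm2 B := by
  simpa [norm2] using norm_add_le (LinearMap.toContinuousLinearMap (Matrix.toEuclideanLin A))
    (LinearMap.toContinuousLinearMap (Matrix.toEuclideanLin B))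

theorem norm2_diagonal_le {d : Fin n → ℝ} {c : ℝ} (hc : 0 ≤ c) (h : ∀ i, |d i| ≤ c) :
    norm2 (diagonal d) ≤ c := by
  refine norm2_le hc fun v => vecNorm2_le_of_dotProduct_le hc ?_
  simp only [dotProduct, mulVec_diagonal, Finset.mul_sum]
  refine Finset.sum_le_sum fun i _ => ?_
  have := sq_le_sq' (neg_le_of_abs_le (h i)) (le_of_abs_le (h i))
  nlinarith [mul_le_mul_of_nonneg_right this (sq_nonneg (v i))]

theorem abs_apply_le_norm2 (A : Matrix (Fin m) (Fin n) ℝ) (i : Fin m) (j : Fin n) :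
    |A i j| ≤ norm2 A := by
  have h := (abs_apply_le_vecNorm2 (A *ᵥ Pi.single j 1) i).trans
    (vecNorm2_mulVec_le A (Pi.single j 1))
  simpa [vecNorm2] using h

theorem abs_le_normF_diagonal (d : Fin n → ℝ) (i : Fin n) : |d i| ≤ normF (diagonal d) := by
  rw [normF, ← Real.sqrt_sq_eq_abs]
  apply Real.sqrt_le_sqrt
  have h1 : d i ^ 2 = diagonal d i i ^ 2 := by simp
  rw [h1]
  exact (Finset.single_le_sum (f := fun j => diagonal d i j ^ 2) (fun _ _ => sq_nonneg _)
    (Finset.mem_univ i)).trans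
    (Finset.single_le_sum (f := fun l => ∑ j, diagonal d l j ^ 2)
      (fun _ _ => Finset.sum_nonneg fun _ _ => sq_nonneg _) (Finset.mem_univ i))

theorem vecNorm2_le_sqrt_mul {v : Fin n → ℝ} {c : ℝ} (hc : 0 ≤ c) (h : ∀ i, |v i| ≤ c) :
    vecNorm2 v ≤ Real.sqrt n * c := by
  refine (pow_le_pow_iff_left₀ (vecNorm2_nonneg v) (by positivity) two_ne_zero).1 ?_
  rw [mul_pow, Real.sq_sqrt (by positivity), vecNorm2_sq]
  calc v ⬝ᵥ v ≤ ∑ _i : Fin n, c ^ 2 := by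
        refine Finset.sum_le_sum fun i _ => ?_
        have := sq_le_sq' (neg_le_of_abs_le (h i)) (le_of_abs_le (h i))
        nlinarith
    _ = n * c ^ 2 := by simp

theorem dotProduct_mulVec_transpose (A : Matrix (Fin m) (Fin n) ℝ) (v : Fin m → ℝ)
    (w : Fin n → ℝ) : v ⬝ᵥ (A *ᵥ w) = (Aᵀ *ᵥ v) ⬝ᵥ w := by
  rw [dotProduct_mulVec, mulVec_transpose]

theorem vecNorm2_mulVec_of_orthonormal {Y : Matrix (Fin n) (Fin k) ℝ} (hY : Yᵀ * Y = 1)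
    (v : Fin k → ℝ) : vecNorm2 (Y *ᵥ v) = vecNorm2 v := by
  have : vecNorm2 (Y *ᵥ v) ^ 2 = vecNorm2 v ^ 2 := by
    rw [vecNorm2_sq, vecNorm2_sq, dotProduct_mulVec_transpose, mulVec_mulVec, hY, one_mulVec]
  exact (pow_left_inj₀ (vecNorm2_nonneg _) (vecNorm2_nonneg _) two_ne_zero).1 this

end Norms

/-! ### Perturbation of sorted eigenvalues and of lowest eigenspaces. -/

section Eigen

variable {n k : ℕ} {A B : Matrix (Fin n) (Fin n) ℝ}

theorem exists_sorted_eigenvectors (hA : A.IsHermitian) :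
    ∃ U : Matrix (Fin n) (Fin n) ℝ, Uᵀ * U = 1 ∧
      A = U * diagonal (ascEigenvalue hA) * Uᵀ := by
  obtain ⟨V, hV⟩ : ∃ V : Matrix (Fin n) (Fin n) ℝ,
      V = (hA.eigenvectorUnitary : Matrix (Fin n) (Fin n) ℝ) := ⟨_, rfl⟩
  have hVV : Vᵀ * V = 1 := by
    have := (Matrix.mem_unitaryGroup_iff').1 hA.eigenvectorUnitary.2
    rw [hV]; simpa [star_eq_conjTranspose] using this
  have hspec : A = V * diagonal hA.eigenvalues * Vᵀ := by
    have := hA.spectral_theorem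
    rw [Unitary.conjStarAlgAut_apply] at this
    rw [hV]
    simpa [star_eq_conjTranspose, Function.comp_def] using this
  -- Mathlib sorts eigenvalues decreasingly; `e` reverses the order and undoes the reindexing in
  -- `eigenvalues`, so permuting the columns of `V` by `e` sorts them increasingly.
  let e : Fin n ≃ Fin n := (Fin.revPerm.trans (finCongr (Fintype.card_fin n).symm)).trans
    (Fintype.equivOfCardEq (Fintype.card_fin _))
  have he : ascEigenvalue hA = hA.eigenvalues ∘ e := by
    funext j
    simp [ascEigenvalue, IsHermitian.eigenvalues, e]
  refine ⟨V.submatrix id e, ?_, ?_⟩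
  · rw [transpose_submatrix, submatrix_mul _ _ e id e Function.bijective_id |>.symm, hVV]
    simp
  · have hd : diagonal (ascEigenvalue hA) = (diagonal hA.eigenvalues).submatrix e e := by
      rw [he, submatrix_diagonal_equiv]
    rw [hd, transpose_submatrix, ← submatrix_mul _ _ id e e e.bijective,
      ← submatrix_mul _ _ id e id e.bijective, ← hspec, submatrix_id_id]

theorem dotProduct_conj_diagonal (U : Matrix (Fin n) (Fin n) ℝ) (d x : Fin n → ℝ) :
    x ⬝ᵥ ((U * diagonal d * Uᵀ) *ᵥ x) = ∑ i, d i * (Uᵀ *ᵥ x) i ^ 2 := by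
  rw [← mulVec_mulVec, ← mulVec_mulVec, dotProduct_mulVec_transpose]
  refine Finset.sum_congr rfl fun i _ => ?_
  rw [mulVec_diagonal]
  ring

theorem dotProduct_self_eq_sum {U : Matrix (Fin n) (Fin n) ℝ} (hU : Uᵀ * U = 1) (x : Fin n → ℝ) :
    x ⬝ᵥ x = ∑ i, (Uᵀ *ᵥ x) i ^ 2 := by
  have h := dotProduct_conj_diagonal U (fun _ => 1) x
  rw [diagonal_one, Matrix.mul_one, mul_eq_one_comm.1 hU, one_mulVec] at h
  simpa using h

/-- In the eigenbasis the form is `∑ dᵢ yᵢ²`, and only weights `dᵢ ≥ d j` meet a nonzero coordinate.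
-/
theorem rayleigh_lower {U : Matrix (Fin n) (Fin n) ℝ} (hU : Uᵀ * U = 1) {d : Fin n → ℝ}
    (hd : Monotone d) (j : Fin n) {x : Fin n → ℝ} (hx : ∀ i < j, (Uᵀ *ᵥ x) i = 0) :
    d j * (x ⬝ᵥ x) ≤ x ⬝ᵥ ((U * diagonal d * Uᵀ) *ᵥ x) := by
  rw [dotProduct_conj_diagonal, dotProduct_self_eq_sum hU, Finset.mul_sum]
  refine Finset.sum_le_sum fun i _ => ?_
  rcases lt_or_ge i j with h | h
  · simp [hx i h]
  · exact mul_le_mul_of_nonneg_right (hd h) (sq_nonneg _)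

theorem rayleigh_upper {U : Matrix (Fin n) (Fin n) ℝ} (hU : Uᵀ * U = 1) {d : Fin n → ℝ}
    (hd : Monotone d) (j : Fin n) {x : Fin n → ℝ} (hx : ∀ i, j < i → (Uᵀ *ᵥ x) i = 0) :
    x ⬝ᵥ ((U * diagonal d * Uᵀ) *ᵥ x) ≤ d j * (x ⬝ᵥ x) := by
  rw [dotProduct_conj_diagonal, dotProduct_self_eq_sum hU, Finset.mul_sum]
  refine Finset.sum_le_sum fun i _ => ?_
  rcases lt_or_ge j i with h | h
  · simp [hx i h]
  · exact mul_le_mul_of_nonneg_right (hd h) (sq_nonneg _)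

/-- Weyl's perturbation inequality. -/
theorem ascEigenvalue_le_add_norm2 (hA : A.IsHermitian) (hB : B.IsHermitian) (j : Fin n) :
    ascEigenvalue hA j ≤ ascEigenvalue hB j + norm2 (A - B) := by
  obtain ⟨U, hU, hAU⟩ := exists_sorted_eigenvectors hA
  obtain ⟨V, hV, hBV⟩ := exists_sorted_eigenvectors hB
  -- Courant-Fischer dimension count: the rows other than `j` impose `n - 1` linear conditions, and
  -- the zero row `j` makes `N` singular. A kernel vector satisfies the hypotheses of both Rayleigh
  -- bounds at once.
  let N : Matrix (Fin n) (Fin n) ℝ := Matrix.of fun i =>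
    if i < j then Uᵀ i else if i = j then 0 else Vᵀ i
  obtain ⟨x, hx0, hx⟩ : ∃ x, x ≠ 0 ∧ N *ᵥ x = 0 := by
    apply Matrix.exists_mulVec_eq_zero_iff.2
    apply det_eq_zero_of_row_eq_zero j
    simp [N]
  have hxU : ∀ i < j, (Uᵀ *ᵥ x) i = 0 := fun i hi => by
    have := congrFun hx i
    simpa [N, mulVec, hi] using this
  have hxV : ∀ i, j < i → (Vᵀ *ᵥ x) i = 0 := fun i hi => by
    have := congrFun hx i
    simpa [N, mulVec, hi.not_gt, hi.ne'] using this
  have h1 := rayleigh_lower hU (ascEigenvalue_monotone hA) j hxU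
  have h2 := rayleigh_upper hV (ascEigenvalue_monotone hB) j hxV
  rw [← hAU] at h1
  rw [← hBV] at h2
  have h3 := dotProduct_le_vecNorm2 x ((A - B) *ᵥ x)
  have h4 := mul_le_mul_of_nonneg_left (vecNorm2_mulVec_le (A - B) x) (vecNorm2_nonneg x)
  have h5 := vecNorm2_sq x
  have h6 : x ⬝ᵥ ((A - B) *ᵥ x) = x ⬝ᵥ (A *ᵥ x) - x ⬝ᵥ (B *ᵥ x) := by
    rw [sub_mulVec, dotProduct_sub]
  have hpos : 0 < x ⬝ᵥ x := by
    have h : 0 < vecNorm2 x := by simpa [vecNorm2] using hx0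
    rw [← h5]
    positivity
  have h7 : vecNorm2 x * (norm2 (A - B) * vecNorm2 x) = norm2 (A - B) * (x ⬝ᵥ x) := by
    rw [← h5]
    ring
  refine le_of_mul_le_mul_right ?_ hpos
  linarith

/-- If there is a spectral gap, the orthogonal complement of a lowest eigenbasis is spanned by
eigenvectors for the other eigenvalues. -/
theorem IsLowestEigenbasis.le_rayleigh {hA : A.IsHermitian} {Y : Matrix (Fin n) (Fin k) ℝ}
    (hY : IsLowestEigenbasis hA Y) {i j : Fin n} (hi : (i : ℕ) + 1 = k) (hj : (j : ℕ) = k)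
    (hgap : ascEigenvalue hA i < ascEigenvalue hA j) {u : Fin n → ℝ} (hu : Yᵀ *ᵥ u = 0) :
    ascEigenvalue hA j * (u ⬝ᵥ u) ≤ u ⬝ᵥ (A *ᵥ u) := by
  obtain ⟨hYY, h, Q, hQ, hAY⟩ := hY
  obtain ⟨U, hU, hAU⟩ := exists_sorted_eigenvectors hA
  set G := Uᵀ * (Y * Q) with hG
  have hUU : U * Uᵀ = 1 := mul_eq_one_comm.1 hU
  have hGG : Gᵀ * G = 1 := by
    calc Gᵀ * G = Qᵀ * (Yᵀ * (U * Uᵀ) * Y) * Q := by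
          simp only [hG, transpose_mul, transpose_transpose, Matrix.mul_assoc]
      _ = 1 := by rw [hUU, Matrix.mul_one, hYY, Matrix.mul_one, hQ]
  have hDG : diagonal (ascEigenvalue hA) * G
      = G * diagonal (fun l => ascEigenvalue hA (Fin.castLE h l)) := by
    calc diagonal (ascEigenvalue hA) * G
        = (Uᵀ * U) * diagonal (ascEigenvalue hA) * Uᵀ * (Y * Q) := by
          rw [hU, Matrix.one_mul, hG, Matrix.mul_assoc]
      _ = Uᵀ * ((U * diagonal (ascEigenvalue hA) * Uᵀ) * Y) * Q := by
          simp only [Matrix.mul_assoc]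
      _ = Uᵀ * (Y * Q) * diagonal (fun l => ascEigenvalue hA (Fin.castLE h l)) * (Qᵀ * Q) := by
          rw [← hAU, hAY]; simp only [Matrix.mul_assoc]
      _ = _ := by rw [hQ, Matrix.mul_one]
  -- Entrywise, `hDG` says `(λ_a - λ_l) G a l = 0`, and the gap excludes `λ_a = λ_l` for `a` beyond
  -- the first `k` indices. The top block `C` of `G` is therefore square and orthogonal, so
  -- orthogonality to `Y` kills the first `k` coordinates of `u`.
  have hG0 : ∀ a : Fin n, a ∉ Set.range (Fin.castLE h) → ∀ l, G a l = 0 := by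
    intro a ha l
    have hka : k ≤ (a : ℕ) := by
      by_contra hlt
      exact ha ⟨⟨a, not_le.1 hlt⟩, by ext; simp⟩
    have e := congrFun (congrFun hDG a) l
    rw [diagonal_mul, mul_diagonal, mul_comm] at e
    have h1 : ascEigenvalue hA j ≤ ascEigenvalue hA a :=
      ascEigenvalue_monotone hA (by rw [Fin.le_def]; omega)
    have h2 : ascEigenvalue hA (Fin.castLE h l) ≤ ascEigenvalue hA i :=
      ascEigenvalue_monotone hA (by rw [Fin.le_def, Fin.val_castLE]; omega)
    by_contra hne
    have := mul_left_cancel₀ hne e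
    linarith
  set C : Matrix (Fin k) (Fin k) ℝ := G.submatrix (Fin.castLE h) id with hC
  have hinj := Fin.castLE_injective h
  have hCC : Cᵀ * C = 1 := by
    rw [← hGG]
    ext a b
    rw [mul_apply, mul_apply]
    refine Fintype.sum_of_injective _ hinj _ _ (fun l hl => ?_) (fun l => rfl)
    rw [hG0 l hl b, mul_zero]
  set g := Uᵀ *ᵥ u with hg
  have hCg : Cᵀ *ᵥ (g ∘ Fin.castLE h) = 0 := by
    have h1 : Gᵀ *ᵥ g = 0 := by
      rw [hG, hg, mulVec_mulVec, transpose_mul, transpose_transpose, Matrix.mul_assoc, hUU,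
        Matrix.mul_one, transpose_mul, ← mulVec_mulVec, hu, mulVec_zero]
    rw [← h1]
    funext a
    refine Fintype.sum_of_injective _ hinj _ _ (fun l hl => ?_) (fun l => rfl)
    exact mul_eq_zero_of_left (hG0 l hl a) _
  have hg0 : g ∘ Fin.castLE h = 0 := by
    rw [← one_mulVec (g ∘ Fin.castLE h), ← mul_eq_one_comm.1 hCC, ← mulVec_mulVec, hCg,
      mulVec_zero]
  have := rayleigh_lower hU (ascEigenvalue_monotone hA) j (x := u) fun a ha =>
    congrFun hg0 ⟨a, by rw [Fin.lt_def] at ha; omega⟩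
  rwa [← hAU] at this

/-- Taking the supremum over `v` leaves `norm2 S` on both sides, and the right-hand occurrence is
absorbed on the left. -/
theorem le_of_forall_vecNorm2_mulVec_le {S : Matrix (Fin n) (Fin k) ℝ} {α β η : ℝ}
    (hα : 0 < α) (hβ : 0 ≤ β) (hη : 0 ≤ η)
    (h : ∀ v, α * vecNorm2 (S *ᵥ v) ≤ (η + norm2 S * β) * vecNorm2 v) :
    (α - β) * norm2 S ≤ η := by
  have : norm2 S ≤ (η + norm2 S * β) / α := by
    refine norm2_le (div_nonneg (add_nonneg hη (mul_nonneg (norm2_nonneg S) hβ)) hα.le)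
      fun v => ?_
    rw [div_mul_eq_mul_div, le_div_iff₀ hα, mul_comm]
    exact h v
  rw [le_div_iff₀ hα] at this
  linarith

theorem vecNorm2_sub_proj_le {X : Matrix (Fin n) (Fin k) ℝ} (hX : Xᵀ * X = 1) (v : Fin n → ℝ) :
    vecNorm2 ((1 - X * Xᵀ) *ᵥ v) ≤ vecNorm2 v := by
  have key : (1 - X * Xᵀ)ᵀ * (1 - X * Xᵀ) = 1 - X * Xᵀ := by
    have : X * Xᵀ * (X * Xᵀ) = X * Xᵀ := by
      rw [Matrix.mul_assoc, ← Matrix.mul_assoc Xᵀ, hX, Matrix.one_mul]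
    simp only [transpose_sub, transpose_one, transpose_mul, transpose_transpose, Matrix.sub_mul,
      Matrix.mul_sub, Matrix.one_mul, Matrix.mul_one, this, sub_self, sub_zero]
  have h := vecNorm2_le_of_dotProduct_le (v := (1 - X * Xᵀ) *ᵥ v) (w := v) zero_le_one (by
    rw [dotProduct_mulVec_transpose, mulVec_mulVec, key, sub_mulVec, one_mulVec, sub_dotProduct,
      ← mulVec_mulVec, dotProduct_comm (X *ᵥ _), dotProduct_mulVec_transpose, ← vecNorm2_sq
      (Xᵀ *ᵥ v)]
    linarith [sq_nonneg (vecNorm2 (Xᵀ *ᵥ v))])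
  simpa using h

/-- The Davis-Kahan `sin Θ` theorem for the lowest eigenspaces. -/
theorem davis_kahan {hA : A.IsHermitian} {hB : B.IsHermitian} {X Y : Matrix (Fin n) (Fin k) ℝ}
    (hX : IsLowestEigenbasis hA X) (hY : IsLowestEigenbasis hB Y) {i j : Fin n}
    (hi : (i : ℕ) + 1 = k) (hj : (j : ℕ) = k) (hgap : ascEigenvalue hA i < ascEigenvalue hA j)
    (hAB : ascEigenvalue hB i < ascEigenvalue hA j) :
    (ascEigenvalue hA j - ascEigenvalue hB i) * norm2 ((1 - X * Xᵀ) * Y) ≤ norm2 (A - B) := by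
  have hray := fun u => hX.le_rayleigh hi hj hgap (u := u)
  obtain ⟨hXX, h, P, hP, hAX⟩ := hX
  obtain ⟨hYY, h', Q, hQ, hBY⟩ := hY
  have hAt : Aᵀ = A := by simpa [IsHermitian] using hA
  set a := ascEigenvalue hA j
  set b := ascEigenvalue hB i
  -- Shifting by the smallest eigenvalue of `B` turns an upper spectral bound into a norm bound: `F
  -- - c` has norm at most `b - c`, while `A - c` is at least `a - c` on the complement of `X`. The
  -- difference of the two is `a - b`, free of `c`.
  set c := ascEigenvalue hB ⟨0, by omega⟩
  have hcb : c ≤ b := ascEigenvalue_monotone hB (by simp [Fin.le_def])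
  set D := P * diagonal (fun l => ascEigenvalue hA (Fin.castLE h l)) * Pᵀ with hD
  have hDt : Dᵀ = D := by
    simp only [hD, transpose_mul, transpose_transpose, diagonal_transpose, Matrix.mul_assoc]
  set F := Q * diagonal (fun l => ascEigenvalue hB (Fin.castLE h l)) * Qᵀ with hF
  replace hBY : B * Y = Y * F := hBY
  set T := 1 - X * Xᵀ with hT
  set S := T * Y with hS
  have hXT : Xᵀ * T = 0 := by
    rw [hT, Matrix.mul_sub, Matrix.mul_one, ← Matrix.mul_assoc, hXX, Matrix.one_mul, sub_self]
  have hcomm : A * T = T * A := by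
    have h1 : Xᵀ * A = D * Xᵀ := by
      have := congrArg transpose hAX
      rwa [transpose_mul, transpose_mul, hAt, hDt] at this
    rw [hT, Matrix.mul_sub, Matrix.sub_mul, Matrix.mul_one, Matrix.one_mul, ← Matrix.mul_assoc,
      hAX, Matrix.mul_assoc X Xᵀ, h1, Matrix.mul_assoc]
  -- Sylvester equation for `S`, obtained because the projector `T` commutes with `A`.
  have hsyl : A * S = T * ((A - B) * Y) + S * F := by
    rw [hS, ← Matrix.mul_assoc, hcomm, Matrix.sub_mul A B Y, hBY, Matrix.mul_sub,
      Matrix.mul_assoc, Matrix.mul_assoc]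
    abel
  have hQQ : Q * Qᵀ = 1 := mul_eq_one_comm.1 hQ
  have hFc : ∀ v, vecNorm2 (F *ᵥ v - c • v) ≤ (b - c) * vecNorm2 v := by
    intro v
    have e : F *ᵥ v - c • v
        = Q *ᵥ (diagonal (fun l => ascEigenvalue hB (Fin.castLE h l) - c) *ᵥ (Qᵀ *ᵥ v)) := by
      have e1 : diagonal (fun l : Fin k => ascEigenvalue hB (Fin.castLE h l) - c)
          = diagonal (fun l : Fin k => ascEigenvalue hB (Fin.castLE h l)) - c • 1 := by
        rw [smul_one_eq_diagonal, diagonal_sub]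
      rw [e1, mulVec_mulVec, mulVec_mulVec, Matrix.mul_sub, Matrix.sub_mul, ← hF,
        sub_mulVec, Matrix.mul_smul, Matrix.mul_one, Matrix.smul_mul, hQQ, smul_mulVec,
        one_mulVec]
    have hQt : (Qᵀ)ᵀ * Qᵀ = 1 := by rwa [transpose_transpose]
    rw [e, vecNorm2_mulVec_of_orthonormal hQ, ← vecNorm2_mulVec_of_orthonormal hQt v]
    refine (vecNorm2_mulVec_le _ _).trans (mul_le_mul_of_nonneg_right ?_ (vecNorm2_nonneg _))
    refine norm2_diagonal_le (sub_nonneg.2 hcb) fun l => ?_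
    have h1 : c ≤ ascEigenvalue hB (Fin.castLE h l) :=
      ascEigenvalue_monotone hB (by simp [Fin.le_def])
    have h2 : ascEigenvalue hB (Fin.castLE h l) ≤ b :=
      ascEigenvalue_monotone hB (by rw [Fin.le_def, Fin.val_castLE]; omega)
    rw [abs_of_nonneg (sub_nonneg.2 h1)]
    linarith
  have hac : 0 < a - c := by linarith
  have main := le_of_forall_vecNorm2_mulVec_le (S := S) hac (sub_nonneg.2 hcb)
    (norm2_nonneg (A - B)) (fun v => by
      set u := S *ᵥ v with hu
      have h1 : a * (u ⬝ᵥ u) ≤ u ⬝ᵥ (A *ᵥ u) := by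
        apply hray
        rw [hu, hS, mulVec_mulVec, ← Matrix.mul_assoc, hXT, Matrix.zero_mul, zero_mulVec]
      have e : A *ᵥ u - c • u = T *ᵥ ((A - B) *ᵥ (Y *ᵥ v)) + S *ᵥ (F *ᵥ v - c • v) := by
        rw [hu, mulVec_mulVec, hsyl, add_mulVec, mulVec_sub, mulVec_smul]
        simp only [← mulVec_mulVec]
        abel
      have h2 : (a - c) * (u ⬝ᵥ u) ≤ u ⬝ᵥ (A *ᵥ u - c • u) := by
        rw [dotProduct_sub, dotProduct_smul, smul_eq_mul]
        linarith
      have h3 := h2.trans (dotProduct_le_vecNorm2 _ _)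
      have h4 : vecNorm2 (A *ᵥ u - c • u) ≤ (norm2 (A - B) + norm2 S * (b - c)) * vecNorm2 v := by
        rw [e]
        refine (vecNorm2_add_le _ _).trans ?_
        rw [add_mul]
        refine add_le_add ?_ ?_
        · refine (vecNorm2_sub_proj_le hXX _).trans ((vecNorm2_mulVec_le _ _).trans ?_)
          rw [vecNorm2_mulVec_of_orthonormal hYY]
        · rw [mul_assoc]
          exact (vecNorm2_mulVec_le _ _).trans
            (mul_le_mul_of_nonneg_left (hFc v) (norm2_nonneg S))
      refine le_trans ?_ h4
      rcases (vecNorm2_nonneg u).eq_or_lt with h0 | h0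
      · rw [← h0, mul_zero]
        exact vecNorm2_nonneg _
      · refine le_of_mul_le_mul_left ?_ h0
        rw [← vecNorm2_sq] at h3
        linarith)
  have : a - c - (b - c) = a - b := by ring
  rwa [this] at main

/-- With `r = v - Y Yᵀ v`, the difference of projectors sends `v` to `X Xᵀ r - (1 - X Xᵀ) Y Yᵀ v`.
These two pieces are orthogonal, as are `r` and `Y Yᵀ v`, so Pythagoras on both sides gives the
bound `s` without a factor `2`. -/
theorem dp2_le {X Y : Matrix (Fin n) (Fin k) ℝ} (hX : Xᵀ * X = 1) (hY : Yᵀ * Y = 1) {s : ℝ}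
    (h1 : norm2 ((1 - X * Xᵀ) * Y) ≤ s) (h2 : norm2 ((1 - Y * Yᵀ) * X) ≤ s) : dp2 X Y ≤ s := by
  have hs : 0 ≤ s := (norm2_nonneg _).trans h1
  -- A matrix and its transpose have the same spectral norm; only this inequality is needed.
  have ht : norm2 (Xᵀ * (1 - Y * Yᵀ)) ≤ s := by
    refine norm2_le hs fun v => ?_
    set w := (Xᵀ * (1 - Y * Yᵀ)) *ᵥ v with hw
    have e : w ⬝ᵥ w = v ⬝ᵥ (((1 - Y * Yᵀ) * X) *ᵥ w) := by
      rw [dotProduct_mulVec_transpose ((1 - Y * Yᵀ) * X), transpose_mul, transpose_sub,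
        transpose_one, transpose_mul, transpose_transpose, ← hw]
    have h3 := dotProduct_le_vecNorm2 v (((1 - Y * Yᵀ) * X) *ᵥ w)
    have h4 := (vecNorm2_mulVec_le ((1 - Y * Yᵀ) * X) w).trans
      (mul_le_mul_of_nonneg_right h2 (vecNorm2_nonneg w))
    rw [← e, ← vecNorm2_sq] at h3
    rcases (vecNorm2_nonneg w).eq_or_lt with h0 | h0
    · rw [← h0]
      exact mul_nonneg hs (vecNorm2_nonneg v)
    · refine le_of_mul_le_mul_left ?_ h0
      nlinarith [mul_le_mul_of_nonneg_left h4 (vecNorm2_nonneg v)]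
  refine norm2_le hs fun v => vecNorm2_le_of_dotProduct_le hs ?_
  set r := v - Y *ᵥ (Yᵀ *ᵥ v) with hr
  set p := Xᵀ *ᵥ r with hp
  set q := ((1 - X * Xᵀ) * Y) *ᵥ (Yᵀ *ᵥ v) with hq
  have hpr : p = (Xᵀ * (1 - Y * Yᵀ)) *ᵥ r := by
    have h0 : Yᵀ *ᵥ r = 0 := by
      rw [hr, mulVec_sub, mulVec_mulVec, mulVec_mulVec, hY, Matrix.one_mul, sub_self]
    rw [← mulVec_mulVec, sub_mulVec, one_mulVec, ← mulVec_mulVec, h0, mulVec_zero, sub_zero]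
  have e1 : (X * Xᵀ - Y * Yᵀ) *ᵥ v = X *ᵥ p - q := by
    simp only [hp, hq, hr, sub_mulVec, mulVec_sub, ← mulVec_mulVec, one_mulVec]
    abel
  have e2 : Xᵀ *ᵥ q = 0 := by
    rw [hq, mulVec_mulVec, ← Matrix.mul_assoc, Matrix.mul_sub, Matrix.mul_one,
      ← Matrix.mul_assoc, hX, Matrix.one_mul, sub_self, Matrix.zero_mul, zero_mulVec]
  have e3 : q ⬝ᵥ (X *ᵥ p) = 0 := by
    rw [dotProduct_mulVec_transpose, e2, zero_dotProduct]
  have e4 : v ⬝ᵥ v = r ⬝ᵥ r + (Yᵀ *ᵥ v) ⬝ᵥ (Yᵀ *ᵥ v) := by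
    have e5 : (Y *ᵥ (Yᵀ *ᵥ v)) ⬝ᵥ (Y *ᵥ (Yᵀ *ᵥ v)) = (Yᵀ *ᵥ v) ⬝ᵥ (Yᵀ *ᵥ v) := by
      rw [← vecNorm2_sq, vecNorm2_mulVec_of_orthonormal hY, vecNorm2_sq]
    have e6 : v ⬝ᵥ (Y *ᵥ (Yᵀ *ᵥ v)) = (Yᵀ *ᵥ v) ⬝ᵥ (Yᵀ *ᵥ v) := dotProduct_mulVec_transpose _ _ _
    rw [hr, dotProduct_sub, sub_dotProduct, sub_dotProduct, e5, e6,
      dotProduct_comm (Y *ᵥ (Yᵀ *ᵥ v)) v, e6]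
    ring
  have b1 : vecNorm2 p ≤ s * vecNorm2 r := by
    rw [hpr]
    exact (vecNorm2_mulVec_le _ _).trans (mul_le_mul_of_nonneg_right ht (vecNorm2_nonneg _))
  have b2 : vecNorm2 q ≤ s * vecNorm2 (Yᵀ *ᵥ v) :=
    (vecNorm2_mulVec_le _ _).trans (mul_le_mul_of_nonneg_right h1 (vecNorm2_nonneg _))
  have c1 := pow_le_pow_left₀ (vecNorm2_nonneg _) b1 2
  have c2 := pow_le_pow_left₀ (vecNorm2_nonneg _) b2 2
  rw [mul_pow, vecNorm2_sq, vecNorm2_sq] at c1 c2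
  rw [e1, e4, dotProduct_sub, sub_dotProduct, sub_dotProduct, e3, dotProduct_comm (X *ᵥ p) q, e3,
    ← vecNorm2_sq (X *ᵥ p), vecNorm2_mulVec_of_orthonormal hX, vecNorm2_sq]
  linarith

end Eigen

/-! ### Lipschitz dependence of the Hamiltonian and one SCF step. -/

namespace Model

variable {n m k : ℕ} (M : Model n m)

theorem XCCondition.nonneg {M : Model n m} {σ : ℝ} (hσ : M.XCCondition σ) : 0 ≤ σ :=
  (norm2_nonneg _).trans (hσ.2.2.2 0)

/-- The density-independent terms cancel, leaving two diagonal matrices. The factor `√n` arises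
because each of the `n` entries of the density difference is a diagonal entry of `X Xᵀ - Z Zᵀ`,
hence at most `dp2 X Z`. -/
theorem norm2_hamiltonian_sub_le {σ : ℝ} (hσ : M.XCCondition σ)
    (X Z : Matrix (Fin n) (Fin k) ℝ) :
    norm2 (M.hamiltonian X - M.hamiltonian Z)
      ≤ Real.sqrt n * (norm2 M.Ldag + σ) * dp2 X Z := by
  have hσ0 := hσ.nonneg
  have hd : 0 ≤ dp2 X Z := norm2_nonneg _
  have hρ : vecNorm2 (density X - density Z) ≤ Real.sqrt n * dp2 X Z :=
    vecNorm2_le_sqrt_mul hd fun i => abs_apply_le_norm2 (X * Xᵀ - Z * Zᵀ) i i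
  have e : M.hamiltonian X - M.hamiltonian Z
      = diagonal (M.Ldag *ᵥ (density X - density Z))
        + diagonal (M.vxc (density X) - M.vxc (density Z)) := by
    have hs : ∀ d d' : Fin n → ℝ, diagonal (d - d') = diagonal d - diagonal d' :=
      fun d d' => (diagonal_sub d d').symm
    rw [mulVec_sub, hs, hs]
    simp only [hamiltonian]
    abel
  have h1 : norm2 (diagonal (M.Ldag *ᵥ (density X - density Z)))
      ≤ norm2 M.Ldag * (Real.sqrt n * dp2 X Z) :=
    norm2_diagonal_le (mul_nonneg (norm2_nonneg _) (by positivity)) fun i =>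
      (abs_apply_le_vecNorm2 _ i).trans ((vecNorm2_mulVec_le _ _).trans
        (mul_le_mul_of_nonneg_left hρ (norm2_nonneg _)))
  have h2 : norm2 (diagonal (M.vxc (density X) - M.vxc (density Z)))
      ≤ σ * (Real.sqrt n * dp2 X Z) := by
    refine norm2_diagonal_le (by positivity) fun i => ?_
    refine (abs_le_normF_diagonal _ i).trans ?_
    have := hσ.2.2.1 (density X) (density Z)
    rw [diagonal_sub] at this
    exact this.trans (mul_le_mul_of_nonneg_left hρ hσ0)
  rw [e]
  refine (norm2_add_le _ _).trans ((add_le_add h1 h2).trans (le_of_eq (by ring)))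

theorem exists_forall_dp2_le {σ δ : ℝ} (hσ : M.XCCondition σ)
    {Xs : Matrix (Fin n) (Fin k) ℝ} (hXs : M.IsKSSolution Xs)
    (hδ : HasGap (M.isHermitian_hamiltonian Xs) k δ) :
    ∃ ε : ℝ, 0 < ε ∧ ∀ X Y : Matrix (Fin n) (Fin k) ℝ, dp2 Xs X < ε → M.IsSCFIterate X Y →
      dp2 Xs Y ≤ 2 * Real.sqrt n * (norm2 M.Ldag + σ) / δ * dp2 Xs X := by
  obtain ⟨hδ0, i, j, hi, hj, hij⟩ := hδ
  have hσ0 := hσ.nonneg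
  set K := Real.sqrt n * (norm2 M.Ldag + σ) with hK
  have hK0 : 0 ≤ K := mul_nonneg (Real.sqrt_nonneg _) (add_nonneg (norm2_nonneg _) hσ0)
  -- The radius forces `K * dp2 Xs X < δ / 4`; the `+ 1` covers `K = 0`.
  refine ⟨δ / (4 * (K + 1)), by positivity, fun X Y hX hXY => ?_⟩
  have hd : 0 ≤ dp2 Xs X := norm2_nonneg _
  have hη := M.norm2_hamiltonian_sub_le hσ Xs X
  rw [← hK] at hη
  have hsmall : K * dp2 Xs X < δ / 4 := by
    rw [lt_div_iff₀ (by positivity)] at hX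
    nlinarith
  have hsymm : norm2 (M.hamiltonian X - M.hamiltonian Xs)
      = norm2 (M.hamiltonian Xs - M.hamiltonian X) := by
    rw [← norm2_neg, neg_sub]
  have w1 := ascEigenvalue_le_add_norm2 (M.isHermitian_hamiltonian X)
    (M.isHermitian_hamiltonian Xs) i
  have w2 := ascEigenvalue_le_add_norm2 (M.isHermitian_hamiltonian Xs)
    (M.isHermitian_hamiltonian X) j
  rw [hsymm] at w1
  -- By Weyl, each mixed separation between the two spectra exceeds `3δ / 4`, and the gap of `H(X)`
  -- itself exceeds `δ / 2`, so both directions apply. Only `δ / 2` is used below.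
  have d1 := davis_kahan hXs hXY hi hj (by linarith) (by linarith)
  have d2 := davis_kahan hXY hXs hi hj (by linarith) (by linarith)
  rw [hsymm] at d2
  have hrhs : 2 * Real.sqrt n * (norm2 M.Ldag + σ) / δ * dp2 Xs X = K * dp2 Xs X / (δ / 2) := by
    rw [hK]
    field_simp
  rw [hrhs]
  refine dp2_le hXs.1 hXY.1 ?_ ?_
  · rw [le_div_iff₀ (by positivity), mul_comm]
    exact (mul_le_mul_of_nonneg_right (by linarith) (norm2_nonneg _)).trans (d1.trans hη)
  · rw [le_div_iff₀ (by positivity), mul_comm]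
    exact (mul_le_mul_of_nonneg_right (by linarith) (norm2_nonneg _)).trans (d2.trans hη)

end Model

end KohnSham

/-! ### The local estimate and linear convergence. -/

theorem mainTheorem2 {n m k : ℕ} (M : KohnSham.Model n m) (σ δ : ℝ) (hσ : M.XCCondition σ)
    (Xs : Matrix (Fin n) (Fin k) ℝ) (hXs : M.IsKSSolution Xs)
    (hδ : KohnSham.HasGap (M.isHermitian_hamiltonian Xs) k δ) :
    (∃ C ε : ℝ, 0 < ε ∧ ∀ X Y : Matrix (Fin n) (Fin k) ℝ,
      Xᵀ * X = 1 → KohnSham.dp2 Xs X < ε → M.IsSCFIterate X Y →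
        KohnSham.dp2 Xs Y ≤
          2 * Real.sqrt n * (KohnSham.norm2 M.Ldag + σ) / δ * KohnSham.dp2 Xs X
            + C * KohnSham.dp2 Xs X ^ 2) ∧
    (2 * Real.sqrt n * (KohnSham.norm2 M.Ldag + σ) < δ →
      ∀ q : ℝ, 2 * Real.sqrt n * (KohnSham.norm2 M.Ldag + σ) / δ < q → q < 1 →
        ∃ ε : ℝ, 0 < ε ∧ ∀ x : ℕ → Matrix (Fin n) (Fin k) ℝ,
          (x 0)ᵀ * x 0 = 1 → KohnSham.dp2 Xs (x 0) < ε →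
          (∀ i, M.IsSCFIterate (x i) (x (i + 1))) →
            (∀ i, KohnSham.dp2 Xs (x (i + 1)) ≤ q * KohnSham.dp2 Xs (x i)) ∧
            Tendsto (fun i => KohnSham.dp2 Xs (x i)) atTop (𝓝 0)) := by
  obtain ⟨ε, hε, h⟩ := M.exists_forall_dp2_le hσ hXs hδ
  refine ⟨⟨0, ε, hε, fun X Y _ hX hXY => by simpa using h X Y hX hXY⟩, fun _ q hq hq1 => ?_⟩
  refine ⟨ε, hε, fun x _ hx0 hx => ?_⟩
  have hd : ∀ i, 0 ≤ KohnSham.dp2 Xs (x i) := fun i => KohnSham.norm2_nonneg _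
  have hq0 : 0 ≤ q := by
    refine le_trans (div_nonneg ?_ hδ.1.le) hq.le
    exact mul_nonneg (by positivity) (add_nonneg (KohnSham.norm2_nonneg _) hσ.nonneg)
  have step : ∀ i, KohnSham.dp2 Xs (x i) < ε →
      KohnSham.dp2 Xs (x (i + 1)) ≤ q * KohnSham.dp2 Xs (x i) := fun i hi =>
    (h _ _ hi (hx i)).trans (mul_le_mul_of_nonneg_right hq.le (hd i))
  -- Since `q < 1`, the iterates never leave the ball in which the one-step estimate holds.
  have small : ∀ i, KohnSham.dp2 Xs (x i) < ε := fun i => by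
    induction i with
    | zero => exact hx0
    | succ i ih => exact ((step i ih).trans (mul_le_of_le_one_left (hd i) hq1.le)).trans_lt ih
  have hall := fun i => step i (small i)
  refine ⟨hall, ?_⟩
  have hgeom : ∀ i, KohnSham.dp2 Xs (x i) ≤ q ^ i * KohnSham.dp2 Xs (x 0) := fun i => by
    induction i with
    | zero => simp
    | succ i ih =>
      refine (hall i).trans ((mul_le_mul_of_nonneg_left ih hq0).trans (le_of_eq ?_))
      ring
  refine squeeze_zero hd hgeom ?_
  simpa using (tendsto_pow_atTop_nhds_zero_of_lt_one hq0 hq1).mul_const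
    (KohnSham.dp2 Xs (x 0))
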